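/- Let $k$ be a commutative ring and $A$ a commutative $k$-algebra. A Hasse–Schmidt derivation of $A$ over $k$ (of infinite length) is a sequence $D=(D_0,D_1,D_2,\dots)$ of $k$-linear maps $A\to A$ with $D_0=\mathrm{Id}_A$ and $D_i(xy)=\sum_{r+s=i}D_r(x)D_s(y)$ for all $i\ge 0$ and $x,y\in A$; then $D_1$ is a $k$-derivation. Let $\mathrm{Der}_k(A)$ be the $A$-module of $k$-linear derivations $A\to A$, and $\mathrm{IDer}_k(A)\subseteq\mathrm{Der}_k(A)$ the submodule of those derivations $\delta$ with $\delta=D_1$ for some Hasse–Schmidt derivation $D$ of $A$ over $k$. The $k$-linear differential operators $A\to A$ of order $\le 0$ are the $A$-linear maps $A\to A$; for $i\ge 0$, a $k$-linear map $\varphi:A\to A$ is a differential operator of order $\le i+1$ if for every $a\in A$ the map $x\mapsto\varphi(ax)-a\varphi(x)$ is a differential operator of order $\le i$. Assume that $\mathrm{IDer}_k(A)=\mathrm{Der}_k(A)$, and that $D^1,\dots,D^n$ ($n\ge 0$) are Hasse–Schmidt derivations of $A$ over $k$ such that $D^1_1,\dots,D^n_1$ form a basis of the $A$-module $\mathrm{Der}_k(A)$.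 Then for every $d\ge 0$, every $k$-linear differential operator $P:A\to A$ of order $\le d$ can be written in the form $$P=\sum_{\alpha\in\mathbb{N}^n,\ |\alpha|\le d}a_\alpha\, D^1_{\alpha_1}\circ\cdots\circ D^n_{\alpha_n},\qquad a_\alpha\in A,$$ with uniquely determined coefficients $a_\alpha$, where $|\alpha|=\alpha_1+\cdots+\alpha_n$. -/

import Mathlib

/-- A Hasse–Schmidt derivation (of infinite length) of the `k`-algebra `A` over `k`: a sequence
`(D₀, D₁, D₂, …)` of `k`-linear maps `A → A` with `D₀ = id` and
`D_i (x y) = ∑_{r + s = i} D_r x * D_s y`. -/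
structure HasseSchmidt (k A : Type*) [CommRing k] [CommRing A] [Algebra k A] where
  /-- the components of the derivation -/
  comp : ℕ → Module.End k A
  comp_zero : comp 0 = LinearMap.id
  comp_mul : ∀ (i : ℕ) (x y : A),
    comp i (x * y) = ∑ p ∈ Finset.HasAntidiagonal.antidiagonal i, comp p.1 x * comp p.2 y

namespace HasseSchmidt

/-- The component of degree `1` of a Hasse–Schmidt derivation, as a derivation. -/
def derivation {k A : Type*} [CommRing k] [CommRing A] [Algebra k A]
    (D : HasseSchmidt k A) : Derivation k A A :=
  Derivation.mk' (D.comp 1) (by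
    intro a b
    rw [D.comp_mul]
    simp [Finset.Nat.antidiagonal_succ, D.comp_zero, mul_comm b])

theorem derivation_apply {k A : Type*} [CommRing k] [CommRing A] [Algebra k A]
    (D : HasseSchmidt k A) (x : A) : D.derivation x = D.comp 1 x := rfl

/-- The identity `(id, 0, 0, …)`. -/
def one (k A : Type*) [CommRing k] [CommRing A] [Algebra k A] : HasseSchmidt k A where
  comp i := if i = 0 then LinearMap.id else 0
  comp_zero := by simp
  comp_mul := by
    intro i x y
    rcases i with _ | i
    · simp
    · rw [Finset.sum_eq_zero]
      · simp
      · rintro ⟨p, q⟩ h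
        rw [Finset.HasAntidiagonal.mem_antidiagonal] at h
        rcases p with _ | p
        · have hq : q ≠ 0 := by simp at h; omega
          simp [hq]
        · simp

/-- The Hasse–Schmidt derivation `(id, b D₁, b² D₂, …)`. -/
def smul {k A : Type*} [CommRing k] [CommRing A] [Algebra k A]
    (b : A) (D : HasseSchmidt k A) : HasseSchmidt k A where
  comp i := b ^ i • D.comp i
  comp_zero := by simp [D.comp_zero]
  comp_mul := by
    intro i x y
    simp only [LinearMap.smul_apply, D.comp_mul, smul_eq_mul, Finset.mul_sum]
    refine Finset.sum_congr rfl ?_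
    rintro ⟨p, q⟩ h
    rw [Finset.HasAntidiagonal.mem_antidiagonal] at h
    subst h
    simp only [pow_add]
    ring

/-- The composition of Hasse–Schmidt derivations:
`(D ∘ E)_n = ∑_{i + j = n} D_i ∘ E_j`. -/
def mul {k A : Type*} [CommRing k] [CommRing A] [Algebra k A]
    (D E : HasseSchmidt k A) : HasseSchmidt k A where
  comp n := ∑ p ∈ Finset.HasAntidiagonal.antidiagonal n, D.comp p.1 ∘ₗ E.comp p.2
  comp_zero := by simp [D.comp_zero, E.comp_zero]
  comp_mul := by
    intro n x y
    simp only [LinearMap.sum_apply, LinearMap.comp_apply, E.comp_mul, map_sum, D.comp_mul,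
      Finset.sum_mul_sum]
    simp only [← Finset.sum_product', Finset.sum_sigma']
    refine Finset.sum_nbij'
      (fun s => ⟨(s.2.2.1 + s.2.1.1, s.2.2.2 + s.2.1.2),
        ((s.2.2.1, s.2.1.1), (s.2.2.2, s.2.1.2))⟩)
      (fun s => ⟨(s.2.1.1 + s.2.2.1, s.2.1.2 + s.2.2.2),
        ⟨(s.2.1.2, s.2.2.2), (s.2.1.1, s.2.2.1)⟩⟩) ?_ ?_ ?_ ?_ ?_
    · rintro ⟨⟨i, j⟩, ⟨c, e⟩, ⟨p, q⟩⟩ h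
      simp at h ⊢
      omega
    · rintro ⟨⟨u, v⟩, ⟨p, c⟩, ⟨q, e⟩⟩ h
      simp at h ⊢
      omega
    · rintro ⟨⟨i, j⟩, ⟨c, e⟩, ⟨p, q⟩⟩ h
      simp at h ⊢
      omega
    · rintro ⟨⟨u, v⟩, ⟨p, c⟩, ⟨q, e⟩⟩ h
      simp at h ⊢
      omega
    · rintro ⟨⟨i, j⟩, ⟨c, e⟩, ⟨p, q⟩⟩ h
      rfl

end HasseSchmidt

/-- The `A`-submodule `IDer_k(A)` of `Der_k(A)` of integrable derivations: the derivations that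
are the component of degree `1` of some Hasse–Schmidt derivation of infinite length. -/
def IDer (k A : Type*) [CommRing k] [CommRing A] [Algebra k A] :
    Submodule A (Derivation k A A) where
  carrier := {δ | ∃ D : HasseSchmidt k A, D.derivation = δ}
  add_mem' := by
    rintro _ _ ⟨D, rfl⟩ ⟨E, rfl⟩
    refine ⟨D.mul E, ?_⟩
    ext x
    simp [HasseSchmidt.derivation_apply, HasseSchmidt.mul, Finset.Nat.antidiagonal_succ,
      D.comp_zero, E.comp_zero, add_comm]
  zero_mem' := by
    refine ⟨HasseSchmidt.one k A, ?_⟩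
    ext x
    simp [HasseSchmidt.derivation_apply, HasseSchmidt.one]
  smul_mem' := by
    rintro b _ ⟨D, rfl⟩
    refine ⟨D.smul b, ?_⟩
    ext x
    simp [HasseSchmidt.derivation_apply, HasseSchmidt.smul]

/-- `diffOp k A i` is the set of `k`-linear differential operators `A → A` of order `≤ i`:
those of order `≤ 0` are the `A`-linear maps, and `φ` has order `≤ i + 1` if for every `a : A` the
commutator `[φ, a] : x ↦ φ (a x) - a φ x` has order `≤ i`. -/
def diffOp (k A : Type*) [CommRing k] [CommRing A] [Algebra k A] : ℕ → Set (Module.End k A)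
  | 0 => {φ | ∃ ψ : A →ₗ[A] A, φ = ψ.restrictScalars k}
  | i + 1 => {φ | ∀ a : A,
      φ ∘ₗ LinearMap.mulLeft k a - LinearMap.mulLeft k a ∘ₗ φ ∈ diffOp k A i}

/-- The monomial `D¹_{α₁} ∘ ⋯ ∘ Dⁿ_{αₙ}` (the product of `Module.End k A` is composition, and the
factors occur in this order). -/
def hsMonomial {k A : Type*} [CommRing k] [CommRing A] [Algebra k A] {n : ℕ}
    (D : Fin n → HasseSchmidt k A) (α : Fin n → ℕ) : Module.End k A :=
  (List.ofFn fun i => (D i).comp (α i)).prod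

/-! Modulo lower order, `[D^α, a]` is `∑ i, D^i_1(a) D^(α - e_i)` (`bracket_hsMonomial_sub_mem`):
the monomials behave like divided powers, so no integer factor ever has to be inverted. Uniqueness:
if a degree `d` combination has order `< d`, bracketing lowers the degree, and independence of the
`D^i_1` kills its coefficients by induction (`coeff_eq_zero_of_homogeneous_mem`). Existence: for `P`
of order `≤ d + 1`, induction gives `[P, a]` leading coefficients `c a β`. By uniqueness `a ↦ c a β`
is a derivation, hence equals `∑ i, e β i D^i_1`. Since `[[P, x], y]` is symmetric in `x, y`, so is
`e` (`coeff_symmetric`), and therefore `e β i = f (β + e_i)` for some `f` (`exists_symmetric_lift`).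
Subtracting `∑ f α D^α` from `P` lowers the order. -/

namespace HSOperators

open Finset

/-! ### Commutators and the order filtration -/

section Filtration

variable {k A : Type*} [CommRing k] [CommRing A] [Algebra k A]

/-- The commutator `φ ↦ [φ, a]` with multiplication by `a`. -/
def bracket (k : Type*) {A : Type*} [CommRing k] [CommRing A] [Algebra k A] (a : A) :
    Module.End k A →ₗ[A] Module.End k A where
  toFun φ := φ ∘ₗ LinearMap.mulLeft k a - LinearMap.mulLeft k a ∘ₗ φ
  map_add' φ ψ := by ext x; simp; ring
  map_smul' c φ := by ext x; simp; ring

theorem bracket_apply (a : A) (φ : Module.End k A) (x : A) :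
    bracket k a φ x = φ (a * x) - a * φ x := rfl

/-- The order filtration on endomorphisms, shifted so that `orderLT k A d` consists of the
differential operators of order `< d`. -/
def orderLT (k A : Type*) [CommRing k] [CommRing A] [Algebra k A] :
    ℕ → Submodule A (Module.End k A)
  | 0 => ⊥
  | d + 1 => ⨅ a : A, (orderLT k A d).comap (bracket k a)

theorem mem_orderLT_zero {φ : Module.End k A} : φ ∈ orderLT k A 0 ↔ φ = 0 := Iff.rfl

theorem mem_orderLT_succ {d : ℕ} {φ : Module.End k A} :
    φ ∈ orderLT k A (d + 1) ↔ ∀ a : A, bracket k a φ ∈ orderLT k A d := by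
  simp [orderLT]

theorem orderLT_le_succ (d : ℕ) : orderLT k A d ≤ orderLT k A (d + 1) := by
  induction d with
  | zero => exact bot_le
  | succ d ih =>
    intro φ hφ
    rw [mem_orderLT_succ] at hφ ⊢
    exact fun a => ih (hφ a)

theorem orderLT_mono : Monotone (orderLT k A) := monotone_nat_of_le_succ orderLT_le_succ

theorem mem_diffOp_iff (d : ℕ) (φ : Module.End k A) :
    φ ∈ diffOp k A d ↔ φ ∈ orderLT k A (d + 1) := by
  induction d generalizing φ with
  | zero =>
    rw [mem_orderLT_succ]
    constructor
    · rintro ⟨ψ, rfl⟩ a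
      rw [mem_orderLT_zero]
      ext x
      simpa [bracket_apply, sub_eq_zero] using ψ.map_smul a x
    · intro h
      refine ⟨{ toFun := φ, map_add' := φ.map_add, map_smul' := fun a x => ?_ }, rfl⟩
      simpa [bracket_apply, sub_eq_zero] using
        LinearMap.congr_fun (mem_orderLT_zero.1 (h a)) x
  | succ d ih =>
    rw [mem_orderLT_succ]
    exact forall_congr' fun a => ih _

theorem bracket_mul (a : A) (φ ψ : Module.End k A) :
    bracket k a (φ * ψ) = φ * bracket k a ψ + bracket k a φ * ψ := by
  ext x
  simp [bracket_apply]

theorem mul_smul_eq (φ ψ : Module.End k A) (a : A) :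
    φ * (a • ψ) = a • (φ * ψ) + bracket k a φ * ψ := by
  ext x
  simp [bracket_apply]

theorem smul_end_sub (a : A) (φ ψ : Module.End k A) : a • (φ - ψ) = a • φ - a • ψ := by
  ext x
  simp [mul_sub]

theorem sub_smul_end (a b : A) (φ : Module.End k A) : (a - b) • φ = a • φ - b • φ := by
  ext x
  simp [sub_mul]

theorem bracket_comm (a b : A) (φ : Module.End k A) :
    bracket k a (bracket k b φ) = bracket k b (bracket k a φ) := by
  ext x
  simp only [bracket_apply]
  rw [mul_left_comm a b x]
  ring

/-- The double bracket drops the order by two, so modulo it `a ↦ [φ, a]` obeys the Leibniz rule. -/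
theorem bracket_mul_left (a b : A) (φ : Module.End k A) :
    bracket k (a * b) φ = a • bracket k b φ + b • bracket k a φ + bracket k b (bracket k a φ) := by
  ext x
  simp only [bracket_apply, LinearMap.add_apply, LinearMap.smul_apply, smul_eq_mul, mul_assoc]
  ring

theorem bracket_add_left (a b : A) (φ : Module.End k A) :
    bracket k (a + b) φ = bracket k a φ + bracket k b φ := by
  ext x
  simp only [bracket_apply, LinearMap.add_apply, add_mul, map_add]
  ring

theorem bracket_smul_left (r : k) (a : A) (φ : Module.End k A) :
    bracket k (r • a) φ = algebraMap k A r • bracket k a φ := by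
  ext x
  simp [bracket_apply, smul_sub]

theorem mul_mem_orderLT {i j : ℕ} {φ ψ : Module.End k A} (hφ : φ ∈ orderLT k A i)
    (hψ : ψ ∈ orderLT k A j) : φ * ψ ∈ orderLT k A (i + j - 1) := by
  induction hm : i + j generalizing i j φ ψ with
  | zero =>
    obtain rfl : i = 0 := by omega
    rw [mem_orderLT_zero.1 hφ, zero_mul]
    exact zero_mem _
  | succ m ih =>
    rcases i with _ | i
    · rw [mem_orderLT_zero.1 hφ, zero_mul]
      exact zero_mem _
    rcases j with _ | j
    · rw [mem_orderLT_zero.1 hψ, mul_zero]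
      exact zero_mem _
    obtain ⟨m, rfl⟩ : ∃ l, m = l + 1 := ⟨i + j, by omega⟩
    rw [Nat.add_sub_cancel, mem_orderLT_succ]
    intro a
    rw [bracket_mul]
    exact add_mem (ih hφ (mem_orderLT_succ.1 hψ a) (by omega))
      (ih (mem_orderLT_succ.1 hφ a) hψ (by omega))

end Filtration

/-! ### Leading terms of commutators with a single component -/

section Components

variable {k A : Type*} [CommRing k] [CommRing A] [Algebra k A]

theorem bracket_comp_succ (D : HasseSchmidt k A) (m : ℕ) (a : A) :
    bracket k a (D.comp (m + 1)) =
      ∑ p ∈ antidiagonal m, D.comp (p.1 + 1) a • D.comp p.2 := by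
  ext x
  simp [bracket_apply, D.comp_mul, D.comp_zero, Finset.Nat.antidiagonal_succ]

theorem comp_mem_orderLT (D : HasseSchmidt k A) (m : ℕ) : D.comp m ∈ orderLT k A (m + 1) := by
  induction m using Nat.strong_induction_on with
  | _ m ih =>
    rw [mem_orderLT_succ]
    intro a
    cases m with
    | zero =>
      rw [mem_orderLT_zero]
      ext x
      simp [bracket_apply, D.comp_zero]
    | succ m =>
      rw [bracket_comp_succ]
      refine sum_mem fun p hp => Submodule.smul_mem _ _ ?_
      have hp := mem_antidiagonal.1 hp
      exact orderLT_mono (by omega) (ih p.2 (by omega))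

/-- The component preceding the `m`-th one, with value `0` for `m = 0`. -/
def prevComp (D : HasseSchmidt k A) (m : ℕ) : Module.End k A :=
  if m = 0 then 0 else D.comp (m - 1)

/-- The leading term is the summand `D_1(a) D_(m-1)` of the Leibniz formula; its coefficient is free
of the factor `m`. -/
theorem bracket_comp_sub_mem (D : HasseSchmidt k A) (m : ℕ) (a : A) :
    bracket k a (D.comp m) - D.derivation a • prevComp D m ∈ orderLT k A (m - 1) := by
  cases m with
  | zero =>
    have h := mem_orderLT_succ.1 (comp_mem_orderLT D 0) a
    simpa [prevComp] using h
  | succ m =>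
    rw [bracket_comp_succ]
    cases m with
    | zero => simp [prevComp, HasseSchmidt.derivation_apply]
    | succ m =>
      rw [Finset.Nat.antidiagonal_succ, sum_cons]
      simp only [prevComp, HasseSchmidt.derivation_apply, sum_map, zero_add, Nat.add_sub_cancel,
        Nat.succ_ne_zero, if_false, add_sub_cancel_left]
      refine sum_mem fun p hp => Submodule.smul_mem _ _ ?_
      have hp := mem_antidiagonal.1 hp
      exact orderLT_mono (by simp; omega) (comp_mem_orderLT D p.2)

end Components

/-! ### Leading terms of commutators with monomials -/

section Monomials

variable {k A : Type*} [CommRing k] [CommRing A] [Algebra k A]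

theorem hsMonomial_succ {n : ℕ} (D : Fin (n + 1) → HasseSchmidt k A) (α : Fin (n + 1) → ℕ) :
    hsMonomial D α = (D 0).comp (α 0) * hsMonomial (Fin.tail D) (Fin.tail α) := by
  simp [hsMonomial, List.ofFn_succ, Fin.tail]

theorem hsMonomial_mem_orderLT {n : ℕ} (D : Fin n → HasseSchmidt k A) (α : Fin n → ℕ) :
    hsMonomial D α ∈ orderLT k A (∑ i, α i + 1) := by
  induction n with
  | zero =>
    rw [mem_orderLT_succ]
    intro a
    have h : bracket k a (hsMonomial D α) = 0 := by
      ext x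
      simp [hsMonomial, bracket_apply]
    rw [h]
    exact zero_mem _
  | succ n ih =>
    rw [hsMonomial_succ, Fin.sum_univ_succ]
    have h := mul_mem_orderLT (comp_mem_orderLT (D 0) (α 0)) (ih (Fin.tail D) (Fin.tail α))
    refine orderLT_mono ?_ h
    simp only [Fin.tail]
    omega

/-- The monomial with the `i`-th exponent lowered by one, with value `0` if that exponent is
zero. -/
def prevMonomial {n : ℕ} (D : Fin n → HasseSchmidt k A) (α : Fin n → ℕ) (i : Fin n) :
    Module.End k A :=
  if α i = 0 then 0 else hsMonomial D (α - Pi.single i 1)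

theorem prevMonomial_zero {n : ℕ} (D : Fin (n + 1) → HasseSchmidt k A) (α : Fin (n + 1) → ℕ) :
    prevMonomial D α 0 = prevComp (D 0) (α 0) * hsMonomial (Fin.tail D) (Fin.tail α) := by
  have h : Fin.tail (α - Pi.single 0 1) = Fin.tail α := by
    ext j
    simp [Fin.tail]
  by_cases h0 : α 0 = 0 <;> simp [prevMonomial, prevComp, h0, hsMonomial_succ, h]

theorem prevMonomial_succ {n : ℕ} (D : Fin (n + 1) → HasseSchmidt k A) (α : Fin (n + 1) → ℕ)
    (i : Fin n) :
    prevMonomial D α i.succ = (D 0).comp (α 0) * prevMonomial (Fin.tail D) (Fin.tail α) i := by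
  have h : Fin.tail (α - Pi.single i.succ 1) = Fin.tail α - Pi.single i 1 := by
    ext j
    simp [Fin.tail, Pi.single_apply]
  have h1 : (α - Pi.single i.succ 1 : Fin (n + 1) → ℕ) 0 = α 0 := by
    simp
  by_cases h0 : α i.succ = 0
  · simp [prevMonomial, Fin.tail, h0]
  · have h0' : Fin.tail α i ≠ 0 := h0
    rw [prevMonomial, prevMonomial, if_neg h0, if_neg h0', hsMonomial_succ, h, h1]

theorem prevMonomial_mem_orderLT {n : ℕ} (D : Fin n → HasseSchmidt k A) (α : Fin n → ℕ)
    (i : Fin n) : prevMonomial D α i ∈ orderLT k A (∑ j, α j) := by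
  rw [prevMonomial]
  split_ifs with h
  · exact zero_mem _
  · refine orderLT_mono ?_ (hsMonomial_mem_orderLT D _)
    refine Nat.succ_le_of_lt (sum_lt_sum (fun j _ => Nat.sub_le _ _) ⟨i, mem_univ i, ?_⟩)
    simp
    omega

/-- Leibniz rule on the first factor times the rest; moving the scalar `D^i_1(a)` to the left past
the first factor costs only a bracket of lower order. -/
theorem bracket_hsMonomial_sub_mem {n : ℕ} (D : Fin n → HasseSchmidt k A) (α : Fin n → ℕ) (a : A) :
    bracket k a (hsMonomial D α) - ∑ i, (D i).derivation a • prevMonomial D α i ∈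
      orderLT k A (∑ i, α i - 1) := by
  induction n with
  | zero =>
    have h : bracket k a (hsMonomial D α) = 0 := by
      ext x
      simp [hsMonomial, bracket_apply]
    simp [h]
  | succ n ih =>
    set φ := (D 0).comp (α 0) with hφ
    set ψ := hsMonomial (Fin.tail D) (Fin.tail α) with hψ
    set R := bracket k a ψ - ∑ i, (Fin.tail D i).derivation a •
      prevMonomial (Fin.tail D) (Fin.tail α) i with hR
    have key : bracket k a (hsMonomial D α) - ∑ i, (D i).derivation a • prevMonomial D α i =
        φ * R + (bracket k a φ - (D 0).derivation a • prevComp (D 0) (α 0)) * ψ +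
        ∑ i, bracket k ((Fin.tail D i).derivation a) φ *
          prevMonomial (Fin.tail D) (Fin.tail α) i := by
      rw [hsMonomial_succ, bracket_mul, Fin.sum_univ_succ, prevMonomial_zero]
      simp only [prevMonomial_succ, hR, mul_sub, sub_mul, mul_sum, mul_smul_eq, sum_add_distrib,
        smul_mul_assoc]
      simp only [← hφ, ← hψ, Fin.tail]
      abel
    have hsum : ∑ i, α i = α 0 + ∑ i, Fin.tail α i := Fin.sum_univ_succ _
    rw [key, hsum]
    refine add_mem (add_mem ?_ ?_) (sum_mem fun i _ => ?_)
    -- In degree `0` the truncated subtraction makes the product bound too weak by one, but the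
    -- remainder is then exactly zero.
    · rcases Nat.eq_zero_or_pos (∑ i, Fin.tail α i) with h0 | h0
      · have hR0 := ih (Fin.tail D) (Fin.tail α)
        rw [h0, Nat.zero_sub, mem_orderLT_zero] at hR0
        rw [hR, hψ, hR0, mul_zero]
        exact zero_mem _
      · exact orderLT_mono (by omega)
          (mul_mem_orderLT (comp_mem_orderLT (D 0) (α 0)) (ih (Fin.tail D) (Fin.tail α)))
    · rcases Nat.eq_zero_or_pos (α 0) with h0 | h0
      · have hφ0 := bracket_comp_sub_mem (D 0) (α 0) a
        rw [h0, Nat.zero_sub, mem_orderLT_zero] at hφ0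
        rw [hφ, h0, hφ0, zero_mul]
        exact zero_mem _
      · exact orderLT_mono (by omega) (mul_mem_orderLT (bracket_comp_sub_mem (D 0) (α 0) a)
          (hsMonomial_mem_orderLT (Fin.tail D) (Fin.tail α)))
    · exact mul_mem_orderLT (mem_orderLT_succ.1 (comp_mem_orderLT (D 0) (α 0)) _)
        (prevMonomial_mem_orderLT _ _ i)

/-- The combination of the monomials of degree `d` with coefficients `c`. -/
def homogeneous {n : ℕ} (D : Fin n → HasseSchmidt k A) (d : ℕ) (c : (Fin n → ℕ) → A) :
    Module.End k A :=
  ∑ α ∈ piAntidiag univ d, c α • hsMonomial D α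

theorem homogeneous_add {n : ℕ} (D : Fin n → HasseSchmidt k A) (d : ℕ) (c c' : (Fin n → ℕ) → A) :
    homogeneous D d (c + c') = homogeneous D d c + homogeneous D d c' := by
  simp [homogeneous, add_smul, sum_add_distrib]

theorem homogeneous_sub {n : ℕ} (D : Fin n → HasseSchmidt k A) (d : ℕ) (c c' : (Fin n → ℕ) → A) :
    homogeneous D d (c - c') = homogeneous D d c - homogeneous D d c' := by
  simp [homogeneous, sub_smul_end, sum_sub_distrib]

theorem homogeneous_smul {n : ℕ} (D : Fin n → HasseSchmidt k A) (d : ℕ) (a : A)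
    (c : (Fin n → ℕ) → A) : homogeneous D d (a • c) = a • homogeneous D d c := by
  simp [homogeneous, smul_sum, mul_smul]

theorem homogeneous_congr {n : ℕ} (D : Fin n → HasseSchmidt k A) (d : ℕ) {c c' : (Fin n → ℕ) → A}
    (h : ∀ α, ∑ i, α i = d → c α = c' α) : homogeneous D d c = homogeneous D d c' :=
  sum_congr rfl fun α hα => by rw [h α (mem_piAntidiag.1 hα).1]

theorem sum_prevMonomial {n : ℕ} (D : Fin n → HasseSchmidt k A) (d : ℕ) (c : (Fin n → ℕ) → A)
    (i : Fin n) :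
    ∑ α ∈ piAntidiag univ (d + 1), c α • prevMonomial D α i =
      homogeneous D d fun β => c (β + Pi.single i 1) := by
  rw [homogeneous, ← sum_filter_add_sum_filter_not _ (fun α : Fin n → ℕ => α i = 0),
    sum_eq_zero, zero_add]
  · symm
    refine sum_nbij' (fun β => β + Pi.single i 1) (fun α => α - Pi.single i 1) ?_ ?_ ?_ ?_ ?_
    · intro β hβ
      simp at hβ ⊢
      simp [sum_add_distrib, hβ]
    · intro α hα
      simp only [mem_filter, mem_piAntidiag, mem_univ, implies_true, and_true] at hα ⊢
      have h : α - Pi.single i 1 + Pi.single i 1 = α := by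
        ext j
        rcases eq_or_ne j i with rfl | hj
        · simp; omega
        · simp [hj]
      have h2 : ∑ j, (α - Pi.single i 1 + Pi.single i 1 : Fin n → ℕ) j = d + 1 := by
        rw [h]; exact hα.1
      simpa [sum_add_distrib] using h2
    · intro β _
      simp
    · intro α hα
      simp only [mem_filter] at hα
      ext j
      rcases eq_or_ne j i with rfl | hj
      · simp; omega
      · simp [hj]
    · intro β _
      simp [prevMonomial]
  · intro α hα
    simp only [mem_filter] at hα
    simp [prevMonomial, hα.2]

theorem bracket_homogeneous_sub_mem {n : ℕ} (D : Fin n → HasseSchmidt k A) (d : ℕ)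
    (c : (Fin n → ℕ) → A) (a : A) :
    bracket k a (homogeneous D (d + 1) c) -
      homogeneous D d (fun β => ∑ i, c (β + Pi.single i 1) * (D i).derivation a) ∈
        orderLT k A d := by
  have h : homogeneous D d (fun β => ∑ i, c (β + Pi.single i 1) * (D i).derivation a) =
      ∑ α ∈ piAntidiag univ (d + 1), c α • ∑ i, (D i).derivation a • prevMonomial D α i := by
    simp only [smul_sum]
    rw [sum_comm]
    simp only [smul_comm (c _), ← smul_sum, sum_prevMonomial]
    simp only [homogeneous, smul_sum, sum_smul]
    rw [sum_comm]
    simp only [smul_smul, mul_comm]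
  rw [h, homogeneous, map_sum, ← sum_sub_distrib]
  refine sum_mem fun α hα => ?_
  rw [map_smul, ← smul_end_sub]
  refine Submodule.smul_mem _ _ ?_
  have := bracket_hsMonomial_sub_mem D α a
  rwa [(mem_piAntidiag.1 hα).1] at this

theorem homogeneous_zero_degree {n : ℕ} (D : Fin n → HasseSchmidt k A) (c : (Fin n → ℕ) → A) :
    homogeneous D 0 c = c 0 • 1 := by
  have h : hsMonomial D 0 = 1 := by
    rw [hsMonomial]
    refine List.prod_eq_one fun φ hφ => ?_
    obtain ⟨i, rfl⟩ := List.mem_ofFn.1 hφ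
    exact (D i).comp_zero
  simp [homogeneous, h]

end Monomials

/-! ### Leading coefficients: uniqueness, symmetry and existence -/

section Symbols

variable {k A : Type*} [CommRing k] [CommRing A] [Algebra k A] {n : ℕ}
  (D : Fin n → HasseSchmidt k A)

theorem sum_smul_derivation_apply (δ : Fin n → Derivation k A A) (c : Fin n → A) (x : A) :
    (∑ i, c i • δ i) x = ∑ i, c i * δ i x := by
  have h := congrFun (map_sum (Derivation.coeFnAddMonoidHom (R := k) (A := A) (M := A))
    (fun i => c i • δ i) univ) x
  rw [Finset.sum_apply] at h
  exact h

theorem eq_zero_of_sum_derivation (hli : LinearIndependent A fun i => (D i).derivation)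
    {c : Fin n → A} (h : ∀ x, ∑ i, c i * (D i).derivation x = 0) (i : Fin n) : c i = 0 := by
  refine Fintype.linearIndependent_iff.1 hli c ?_ i
  ext x
  rw [sum_smul_derivation_apply, h x, Derivation.zero_apply]

theorem coeff_eq_zero_of_homogeneous_mem
    (hli : LinearIndependent A fun i => (D i).derivation) (d : ℕ) {c : (Fin n → ℕ) → A}
    (h : homogeneous D d c ∈ orderLT k A d) (α : Fin n → ℕ) (hα : ∑ i, α i = d) : c α = 0 := by
  induction d generalizing c α with
  | zero =>
    obtain rfl : α = 0 := by
      ext i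
      exact sum_eq_zero_iff.1 hα i (mem_univ i)
    rw [homogeneous_zero_degree, mem_orderLT_zero] at h
    simpa using LinearMap.congr_fun h 1
  | succ d ih =>
    obtain ⟨i, -, hi⟩ : ∃ i ∈ univ, α i ≠ 0 := by
      apply exists_ne_zero_of_sum_ne_zero
      omega
    have hadd : α - Pi.single i 1 + Pi.single i 1 = α := by
      ext j
      rcases eq_or_ne j i with rfl | hj
      · simp; omega
      · simp [hj]
    have hsum : ∑ j, (α - Pi.single i 1 : Fin n → ℕ) j = d := by
      have h2 : ∑ j, (α - Pi.single i 1 + Pi.single i 1 : Fin n → ℕ) j = d + 1 := by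
        rw [hadd, hα]
      simpa [sum_add_distrib] using h2
    have hz : ∀ x, ∑ j, c (α - Pi.single i 1 + Pi.single j 1) * (D j).derivation x = 0 := by
      intro x
      refine ih (c := fun β => ∑ j, c (β + Pi.single j 1) * (D j).derivation x) ?_ _ hsum
      have h1 := sub_mem (mem_orderLT_succ.1 h x) (bracket_homogeneous_sub_mem D d c x)
      rwa [sub_sub_cancel] at h1
    have := eq_zero_of_sum_derivation D hli hz i
    rwa [hadd] at this

theorem coeff_eq_of_homogeneous_sub_mem
    (hli : LinearIndependent A fun i => (D i).derivation) {d : ℕ} {P : Module.End k A}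
    {c c' : (Fin n → ℕ) → A} (h : P - homogeneous D d c ∈ orderLT k A d)
    (h' : P - homogeneous D d c' ∈ orderLT k A d) (α : Fin n → ℕ) (hα : ∑ i, α i = d) :
    c α = c' α := by
  refine sub_eq_zero.1 (coeff_eq_zero_of_homogeneous_mem D hli d (c := c - c') ?_ α hα)
  rw [homogeneous_sub]
  have := sub_mem h' h
  rwa [sub_sub_sub_cancel_left] at this

theorem exists_symmetric_lift {d : ℕ} (e : (Fin n → ℕ) → Fin n → A)
    (he : ∀ (γ : Fin n → ℕ) (i j : Fin n), ∑ l, γ l + 1 = d →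
      e (γ + Pi.single j 1) i = e (γ + Pi.single i 1) j) :
    ∃ c : (Fin n → ℕ) → A, ∀ (β : Fin n → ℕ) (i : Fin n), ∑ l, β l = d →
      c (β + Pi.single i 1) = e β i := by
  classical
  -- Any nonzero index can be lowered: `he` makes the choice immaterial. The default at `α = 0` is
  -- never reached, as `β + e_i ≠ 0`.
  refine ⟨fun α => if h : ∃ j, α j ≠ 0 then e (α - Pi.single h.choose 1) h.choose else 0, ?_⟩
  intro β i hβ
  have h : ∃ j, (β + Pi.single i 1 : Fin n → ℕ) j ≠ 0 := ⟨i, by simp⟩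
  beta_reduce
  rw [dif_pos h]
  have hj := h.choose_spec
  generalize h.choose = j at hj
  rcases eq_or_ne j i with rfl | hji
  · simp
  · have hj0 : β j ≠ 0 := by simpa [hji] using hj
    have hβj : β = (β - Pi.single j 1) + Pi.single j 1 := by
      ext l
      rcases eq_or_ne l j with rfl | hl
      · simp; omega
      · simp [hl]
    generalize β - Pi.single j 1 = γ at hβj
    subst hβj
    have hsub : γ + Pi.single j 1 + Pi.single i 1 - Pi.single j 1 = γ + Pi.single i 1 := by
      rw [add_right_comm, add_tsub_cancel_right]
    rw [hsub]
    exact (he γ i j (by simpa [sum_add_distrib] using hβ)).symm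

/-- Compare the leading coefficients of `[[P, x], y] = [[P, y], x]`, then use linear independence
twice, in `y` and in `x`. -/
theorem coeff_symmetric (hli : LinearIndependent A fun i => (D i).derivation) {d : ℕ}
    {P : Module.End k A} {e : (Fin n → ℕ) → Fin n → A}
    (hP : ∀ a, bracket k a P -
      homogeneous D d (fun β => ∑ i, e β i * (D i).derivation a) ∈ orderLT k A d)
    (γ : Fin n → ℕ) (i j : Fin n) (hγ : ∑ l, γ l + 1 = d) :
    e (γ + Pi.single j 1) i = e (γ + Pi.single i 1) j := by
  subst hγ
  have h2 : ∀ x y, bracket k y (bracket k x P) -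
      homogeneous D (∑ l, γ l) (fun γ' => ∑ j, (∑ i, e (γ' + Pi.single j 1) i *
        (D i).derivation x) * (D j).derivation y) ∈ orderLT k A (∑ l, γ l) := by
    intro x y
    have h3 := mem_orderLT_succ.1 (hP x) y
    rw [map_sub] at h3
    have h4 := add_mem h3 (bracket_homogeneous_sub_mem D (∑ l, γ l)
      (fun β => ∑ i, e β i * (D i).derivation x) y)
    rwa [sub_add_sub_cancel] at h4
  have h5 : ∀ x y, ∑ j, (∑ i, e (γ + Pi.single j 1) i * (D i).derivation x) *
      (D j).derivation y = ∑ j, (∑ i, e (γ + Pi.single j 1) i * (D i).derivation y) *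
      (D j).derivation x := by
    intro x y
    have h6 := h2 y x
    rw [bracket_comm] at h6
    exact coeff_eq_of_homogeneous_sub_mem D hli (h2 x y) h6 γ rfl
  have h7 : ∀ x (j : Fin n), ∑ i, (e (γ + Pi.single j 1) i - e (γ + Pi.single i 1) j) *
      (D i).derivation x = 0 := by
    intro x j
    refine eq_zero_of_sum_derivation D hli (c := fun j => ∑ i, (e (γ + Pi.single j 1) i -
      e (γ + Pi.single i 1) j) * (D i).derivation x) (fun y => ?_) j
    simp only [sub_mul, sum_sub_distrib]
    rw [h5 x y, sub_eq_zero]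
    simp only [sum_mul]
    rw [sum_comm]
    exact sum_congr rfl fun _ _ => sum_congr rfl fun _ _ => by ring
  exact sub_eq_zero.1 (eq_zero_of_sum_derivation D hli (fun x => h7 x j) i)

theorem exists_homogeneous_sub_mem (b : Module.Basis (Fin n) A (Derivation k A A))
    (hb : ∀ i, b i = (D i).derivation) (d : ℕ) (P : Module.End k A)
    (hP : P ∈ orderLT k A (d + 1)) :
    ∃ c : (Fin n → ℕ) → A, P - homogeneous D d c ∈ orderLT k A d := by
  have hli : LinearIndependent A fun i => (D i).derivation := by
    simpa only [funext hb] using b.linearIndependent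
  induction d generalizing P with
  | zero =>
    -- An `A`-linear map is multiplication by its value at `1`.
    refine ⟨fun _ => P 1, ?_⟩
    rw [homogeneous_zero_degree, mem_orderLT_zero]
    ext x
    have := LinearMap.congr_fun (mem_orderLT_zero.1 (mem_orderLT_succ.1 hP x)) 1
    simp only [bracket_apply, mul_one, LinearMap.zero_apply] at this
    simpa [mul_comm] using this
  | succ d ih =>
    choose c hc using fun a => ih (bracket k a P) (mem_orderLT_succ.1 hP a)
    have hadd : ∀ β, ∑ i, β i = d → ∀ x y, c (x + y) β = c x β + c y β := by
      intro β hβ x y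
      refine coeff_eq_of_homogeneous_sub_mem D hli (hc (x + y)) (c' := c x + c y) ?_ β hβ
      rw [bracket_add_left, homogeneous_add, add_sub_add_comm]
      exact add_mem (hc x) (hc y)
    have hsmul : ∀ β, ∑ i, β i = d → ∀ (r : k) x, c (r • x) β = r • c x β := by
      intro β hβ r x
      rw [Algebra.smul_def r (c x β)]
      refine coeff_eq_of_homogeneous_sub_mem D hli (hc (r • x)) (c' := algebraMap k A r • c x)
        ?_ β hβ
      rw [bracket_smul_left, homogeneous_smul, ← smul_end_sub]
      exact Submodule.smul_mem _ _ (hc x)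
    have hmul : ∀ β, ∑ i, β i = d → ∀ x y, c (x * y) β = x • c y β + y • c x β := by
      intro β hβ x y
      refine coeff_eq_of_homogeneous_sub_mem D hli (hc (x * y)) (c' := x • c y + y • c x) ?_ β hβ
      rw [bracket_mul_left, homogeneous_add, homogeneous_smul, homogeneous_smul,
        add_sub_right_comm, add_sub_add_comm, ← smul_end_sub, ← smul_end_sub]
      exact add_mem (add_mem (Submodule.smul_mem _ _ (hc y)) (Submodule.smul_mem _ _ (hc x)))
        -- The double bracket has order `< d`, hence does not affect the degree `d` coefficients.
        (mem_orderLT_succ.1 (mem_orderLT_succ.1 hP x) y)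
    have hder : ∀ β : Fin n → ℕ, ∃ e : Fin n → A, ∑ i, β i = d →
        ∀ x, c x β = ∑ i, e i * (D i).derivation x := by
      intro β
      by_cases hβ : ∑ i, β i = d
      · let δ : Derivation k A A := Derivation.mk'
          { toFun := fun x => c x β, map_add' := hadd β hβ, map_smul' := hsmul β hβ }
          (hmul β hβ)
        refine ⟨b.repr δ, fun _ x => ?_⟩
        have h := congrArg (fun η : Derivation k A A => η x) (b.sum_repr δ)
        simp only [sum_smul_derivation_apply, hb] at h
        exact h.symm
      · exact ⟨0, fun h => absurd h hβ⟩
    choose e he using hder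
    have hPe : ∀ a, bracket k a P -
        homogeneous D d (fun β => ∑ i, e β i * (D i).derivation a) ∈ orderLT k A d := by
      intro a
      rw [← homogeneous_congr D d fun β hβ => he β hβ a]
      exact hc a
    obtain ⟨f, hf⟩ := exists_symmetric_lift e (coeff_symmetric D hli hPe)
    refine ⟨f, mem_orderLT_succ.2 fun a => ?_⟩
    have h := sub_mem (hPe a) (bracket_homogeneous_sub_mem D d f a)
    have hfe : homogeneous D d (fun β => ∑ i, f (β + Pi.single i 1) * (D i).derivation a) =
        homogeneous D d (fun β => ∑ i, e β i * (D i).derivation a) :=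
      homogeneous_congr D d fun β hβ => by simp only [hf β _ hβ]
    rw [hfe, sub_sub_sub_cancel_right] at h
    rwa [map_sub]

/-! ### From leading terms to full expansions -/

theorem exists_finsupp_eq (b : Module.Basis (Fin n) A (Derivation k A A))
    (hb : ∀ i, b i = (D i).derivation) (d : ℕ) (P : Module.End k A)
    (hP : P ∈ orderLT k A d) :
    ∃ a : (Fin n → ℕ) →₀ A, (∀ α ∈ a.support, ∑ i, α i < d) ∧
      P = a.sum fun α c => c • hsMonomial D α := by
  classical
  induction d generalizing P with
  | zero => exact ⟨0, by simp, by simpa using mem_orderLT_zero.1 hP⟩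
  | succ d ih =>
    obtain ⟨c, hc⟩ := exists_homogeneous_sub_mem D b hb d P hP
    obtain ⟨a, ha, hPa⟩ := ih _ hc
    refine ⟨a + ∑ α ∈ piAntidiag univ d, Finsupp.single α (c α), fun α hα => ?_, ?_⟩
    · by_contra hlt
      have h1 : a α = 0 := Finsupp.notMem_support_iff.1 fun h => by
        exact hlt ((ha α h).trans (Nat.lt_succ_self d))
      rw [Finsupp.mem_support_iff, Finsupp.add_apply, h1, zero_add, Finsupp.finsetSum_apply] at hα
      refine hα (sum_eq_zero fun β hβ => ?_)
      have hβ := (mem_piAntidiag.1 hβ).1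
      refine Finsupp.single_eq_of_ne ?_
      rintro rfl
      exact hlt (hβ.trans_lt (Nat.lt_succ_self d))
    · rw [Finsupp.sum_add_index' (by simp) (by simp [add_smul]), ← hPa,
        ← Finsupp.sum_finsetSum_index (by simp) (by simp [add_smul])]
      simp [homogeneous]

theorem finsupp_eq_zero (hli : LinearIndependent A fun i => (D i).derivation) (d : ℕ)
    (a : (Fin n → ℕ) →₀ A) (ha : ∀ α ∈ a.support, ∑ i, α i < d)
    (h : (a.sum fun α c => c • hsMonomial D α) = 0) : a = 0 := by
  classical
  induction d with
  | zero => exact Finsupp.support_eq_empty.1 (eq_empty_of_forall_notMem fun α hα => by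
      simpa using ha α hα)
  | succ d ih =>
    refine ih fun α hα => (Nat.lt_succ_iff.1 (ha α hα)).lt_of_ne fun hd => ?_
    refine Finsupp.mem_support_iff.1 hα
      (coeff_eq_zero_of_homogeneous_mem D hli d (c := a) ?_ α hd)
    have h1 : homogeneous D d a =
        ∑ α ∈ a.support with ∑ i, α i = d, a α • hsMonomial D α := by
      symm
      refine sum_subset (fun α hα => ?_) fun α hα hα' => ?_
      · simpa using (mem_filter.1 hα).2
      · have hαd := (mem_piAntidiag.1 hα).1
        have : a α = 0 := by
          by_contra h0
          exact hα' (mem_filter.2 ⟨Finsupp.mem_support_iff.2 h0, hαd⟩)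
        rw [this, zero_smul]
    rw [Finsupp.sum, ← sum_filter_add_sum_filter_not _ (fun α : Fin n → ℕ => ∑ i, α i = d),
      ← h1] at h
    -- The top-degree part is minus the sum of the lower monomials, so it has order `< d`.
    rw [eq_neg_of_add_eq_zero_left h]
    refine neg_mem (sum_mem fun α hα => Submodule.smul_mem _ _ ?_)
    rw [mem_filter] at hα
    have := ha α hα.1
    exact orderLT_mono (by omega) (hsMonomial_mem_orderLT D α)

end Symbols

end HSOperators

theorem mainTheorem8 {k A : Type*} [CommRing k] [CommRing A] [Algebra k A]
    (hI : IDer k A = ⊤) (n : ℕ) (D : Fin n → HasseSchmidt k A)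
    (b : Module.Basis (Fin n) A (Derivation k A A)) (hb : ∀ i, b i = (D i).derivation)
    (d : ℕ) (P : Module.End k A) (hP : P ∈ diffOp k A d) :
    ∃! a : (Fin n → ℕ) →₀ A,
      (∀ α ∈ a.support, ∑ i, α i ≤ d) ∧ P = a.sum fun α c => c • hsMonomial D α := by
  classical
  obtain ⟨a, ha, hPa⟩ := HSOperators.exists_finsupp_eq D b hb (d + 1) P
    ((HSOperators.mem_diffOp_iff d P).1 hP)
  refine ⟨a, ⟨fun α hα => Nat.lt_succ_iff.1 (ha α hα), hPa⟩, ?_⟩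
  rintro a' ⟨ha', hPa'⟩
  have hli : LinearIndependent A fun i => (D i).derivation := by
    simpa only [funext hb] using b.linearIndependent
  refine sub_eq_zero.1 (HSOperators.finsupp_eq_zero D hli (d + 1) (a' - a) (fun α hα => ?_) ?_)
  · rcases Finset.mem_union.1 (Finsupp.support_sub hα) with h | h
    · exact Nat.lt_succ_iff.2 (ha' α h)
    · exact ha α h
  · rw [Finsupp.sum_sub_index fun α c c' => HSOperators.sub_smul_end c c' (hsMonomial D α), ← hPa, ← hPa', sub_self]
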